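/- Let $\lambda$ and $\kappa$ be infinite cardinals with $\lambda$ regular and $\kappa\ge\lambda$. The following conditions are equivalent. (1) The power $\omega^\kappa$ (the product of $\kappa$ copies of the countable discrete space $\omega$, with the Tychonoff topology) is $[\lambda,\lambda]$-compact, that is, every open cover of it by at most $\lambda$ sets has a subcover by fewer than $\lambda$ sets. (2) The infinitary language $\mathcal L_{\omega_1,\omega}$ (countable conjunctions and disjunctions, quantification over finitely many variables, over arbitrary vocabularies) is $\kappa$-$(\lambda,\lambda)$-compact, that is, whenever $\Sigma$ and $\Gamma$ are sets of $\mathcal L_{\omega_1,\omega}$-sentences over the same vocabulary with $|\Sigma|\le\kappa$ and $|\Gamma|\le\lambda$, and $\Sigma\cup\Gamma'$ is satisfiable for every $\Gamma'\subseteq\Gamma$ with $|\Gamma'|<\lambda$, then $\Sigma\cup\Gamma$ is satisfiable. (3) $\lambda\stackrel{\kappa}{\not\Rightarrow}\omega$, that is, for every sequence $(f_\gamma)_{\gamma\in\kappa}$ of functions $f_\gamma:\lambda\to\omega$ there is a uniform ultrafilter $D$ over $\lambda$ such that for no $\gamma\in\kappa$ is the image ultrafilter $f_\gamma(D)=\{Y\subseteq\omega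 : f_\gamma^{-1}(Y)\in D\}$ uniform over $\omega$. (An ultrafilter over a set $I$ is uniform if all its members have cardinality $|I|$.) In particular, if $\lambda$ is a regular infinite cardinal, then $\omega^\lambda$ is finally $\lambda$-compact (every open cover has a subcover of cardinality strictly less than $\lambda$) if and only if $\mathcal L_{\omega_1,\omega}$ is $(\lambda,\lambda)$-compact (every set of at most $\lambda$ sentences, all of whose subsets of cardinality less than $\lambda$ are satisfiable, is satisfiable). -/

import Mathlib

open Cardinal

universe u v w

/-- A space is `[mu, lam]`-compact if every open cover by at most `lam` sets has a subcover by
fewer than `mu` sets. -/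
def IsIntervalCompact (mu lam : Cardinal.{u}) (X : Type u) [TopologicalSpace X] : Prop :=
  ∀ C : Set (Set X), (∀ U ∈ C, IsOpen U) → ⋃₀ C = Set.univ → #C ≤ lam →
    ∃ C' : Set (Set X), C' ⊆ C ∧ ⋃₀ C' = Set.univ ∧ #C' < mu

/-- A space is finally `lam`-compact if every open cover has a subcover of cardinality strictly
less than `lam`. -/
def IsFinallyCompact (lam : Cardinal.{u}) (X : Type u) [TopologicalSpace X] : Prop :=
  ∀ C : Set (Set X), (∀ U ∈ C, IsOpen U) → ⋃₀ C = Set.univ →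
    ∃ C' : Set (Set X), C' ⊆ C ∧ ⋃₀ C' = Set.univ ∧ #C' < lam

/-- The power `ω ^ κ`, as the set of all functions from a set of cardinality `κ` to `ℕ`.  Its
topology is the product (Tychonoff) topology, where `ℕ` is discrete. -/
abbrev OmegaPower (kappa : Cardinal.{u}) : Type u := kappa.out → ℕ

/-- An ultrafilter over `A` is uniform if all its members have the cardinality of `A`. -/
def IsUniformUltrafilter {A : Type u} (D : Ultrafilter A) : Prop :=
  ∀ s : Set A, s ∈ D → #s = #A

/-- The principle `A ⇏ (B γ)_{γ ∈ K}`: for all functions `f γ : A → B γ` (`γ ∈ K`), some uniform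
ultrafilter `D` over `A` is such that for no `γ` the image ultrafilter `f γ (D)` is uniform over
`B γ`. Only the cardinalities of `A`, `K`, `B γ` matter. -/
def NotArrowFamily (A : Type u) {K : Type v} (B : K → Type w) : Prop :=
  ∀ f : (γ : K) → A → B γ, ∃ D : Ultrafilter A,
    IsUniformUltrafilter D ∧ ∀ γ : K, ¬ IsUniformUltrafilter (D.map (f γ))

/-- The principle `lam ⇏^kappa ω`. -/
def NotArrowOmega (lam kappa : Cardinal.{u}) : Prop :=
  NotArrowFamily lam.out (fun _ : kappa.out => ℕ)

/-- Formulas of the infinitary language `L_{ω₁,ω}` over a vocabulary `L`, with free variables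
among the `n` variables indexed by `Fin n`: countable conjunctions and disjunctions and finite
strings of quantifiers are allowed.  Nonempty finite conjunctions and disjunctions are those of
sequences with repetitions; the empty ones are `neg falsum` and `falsum`.  In a quantified
formula, the bound variable is the last one.  (Every subformula of a sentence has only finitely
many free variables, so that no sentence of `L_{ω₁,ω}` is lost.) -/
inductive InfFormula (L : FirstOrder.Language.{u, u}) : ℕ → Type u
  | falsum {n : ℕ} : InfFormula L n
  | equal {n : ℕ} (t s : L.Term (Fin n)) : InfFormula L n
  | rel {n l : ℕ} (R : L.Relations l) (ts : Fin l → L.Term (Fin n)) : InfFormula L n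
  | neg {n : ℕ} (φ : InfFormula L n) : InfFormula L n
  | conj {n : ℕ} (φ : ℕ → InfFormula L n) : InfFormula L n
  | disj {n : ℕ} (φ : ℕ → InfFormula L n) : InfFormula L n
  | all {n : ℕ} (φ : InfFormula L (n + 1)) : InfFormula L n
  | ex {n : ℕ} (φ : InfFormula L (n + 1)) : InfFormula L n

/-- Truth of an `L_{ω₁,ω}` formula in the structure `M` under an assignment of its variables. -/
def InfFormula.Realize {L : FirstOrder.Language.{u, u}} (M : Type u) [L.Structure M] :
    {n : ℕ} → InfFormula L n → (Fin n → M) → Prop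
  | _, .falsum, _ => False
  | _, .equal t s, xs => t.realize xs = s.realize xs
  | _, .rel R ts, xs => FirstOrder.Language.Structure.RelMap R (fun i => (ts i).realize xs)
  | _, .neg φ, xs => ¬ φ.Realize M xs
  | _, .conj φ, xs => ∀ i : ℕ, (φ i).Realize M xs
  | _, .disj φ, xs => ∃ i : ℕ, (φ i).Realize M xs
  | _, .all φ, xs => ∀ a : M, φ.Realize M (Fin.snoc (α := fun _ => M) xs a)
  | _, .ex φ, xs => ∃ a : M, φ.Realize M (Fin.snoc (α := fun _ => M) xs a)

/-- Sentences of `L_{ω₁,ω}` over the vocabulary `L`. -/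
abbrev InfSentence (L : FirstOrder.Language.{u, u}) : Type u := InfFormula L 0

/-- A set of `L_{ω₁,ω}` sentences is satisfiable if it has a (nonempty) model. -/
def InfSatisfiable {L : FirstOrder.Language.{u, u}} (T : Set (InfSentence L)) : Prop :=
  ∃ (M : Type u) (_ : Nonempty M) (_ : L.Structure M), ∀ φ ∈ T, φ.Realize M Fin.elim0

/-- `Γ` is `mu`-satisfiable relative to `S`: for every `Γ' ⊆ Γ` of cardinality less than `mu`,
`S ∪ Γ'` is satisfiable. -/
def InfSatisfiableRel {L : FirstOrder.Language.{u, u}} (mu : Cardinal.{u}) (S Γ : Set (InfSentence L)) :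
    Prop :=
  ∀ Γ' : Set (InfSentence L), Γ' ⊆ Γ → #Γ' < mu → InfSatisfiable (S ∪ Γ')

/-- `L_{ω₁,ω}` is `kappa`-`(lam, mu)`-compact: for every vocabulary and all sets `S`, `Γ` of
sentences with `|S| ≤ kappa` and `|Γ| ≤ lam`, if `Γ` is `mu`-satisfiable relative to `S`, then
`S ∪ Γ` is satisfiable. -/
def InfRelCompact (kappa lam mu : Cardinal.{u}) : Prop :=
  ∀ (L : FirstOrder.Language.{u, u}) (S Γ : Set (InfSentence L)), #S ≤ kappa → #Γ ≤ lam →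
    InfSatisfiableRel mu S Γ → InfSatisfiable (S ∪ Γ)

/-- `L_{ω₁,ω}` is `(lam, mu)`-compact: every set of at most `lam` sentences, all of whose subsets
of cardinality less than `mu` are satisfiable, is satisfiable. -/
def InfCompact (lam mu : Cardinal.{u}) : Prop :=
  ∀ (L : FirstOrder.Language.{u, u}) (Γ : Set (InfSentence L)), #Γ ≤ lam →
    (∀ Γ' : Set (InfSentence L), Γ' ⊆ Γ → #Γ' < mu → InfSatisfiable Γ') → InfSatisfiable Γ

/-!
# Compactness of powers of the integers and of `L_{ω₁,ω}`

Let `λ` be regular, `ι` a set of cardinality `λ` and `K` a set of cardinality `κ ≥ λ`. All three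
conditions are equivalent to the statement that every sequence `g : ι → (K → ℕ)` has an
accumulation point, that is, a cluster point along the filter of sets whose complement has fewer
than `λ` elements.

* For `[λ, λ]`-compactness this holds in every space, because `ι` has a well-order in which every
  initial segment, and by regularity no cofinal set, has fewer than `λ` elements
  (`isIntervalCompact_iff_forall_exists_mapClusterPt`).
* A cluster point is a limit along an ultrafilter finer than the filter. The ultrafilters concerned
  are the uniform ones, and in a product of discrete spaces convergence along `D` says that every
  coordinate is constant on a member of `D`, so that its image of `D` is not uniform over `ℕ`
  (`notArrowFamily_nat_iff_forall_exists_mapClusterPt`).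
* Propositional `L_{ω₁,ω}` suffices to get accumulation points from compactness. The
  variables `(γ, n)` and `b` say of an unknown index `i` that `g i γ = n` and that `i ≤ b`. There
  are at most `κ` sentences of the forms "`γ` has a value" and "if `i` satisfies the finite list `l`
  of equations then `i ≤ b`", the latter for all `l` and `b` for which this is true of every `i`.
  A model of them in which every `b` is false gives each `γ` a value `x γ`, and the indices that
  satisfy a given finite list of equations `g i γ = x γ` are then unbounded
  (`exists_mapClusterPt_of_infRelCompact`).
* In the other direction, choose models `M i` of `Σ` and of the part of `Γ` enumerated up to `i`.
  Their ultraproduct by a uniform ultrafilter need not satisfy Łoś's theorem for infinite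
  disjunctions. It does so on the set `A/D` of elements represented in a family `A` of choice
  functions, if `A` is closed under countably many operations for each sentence (functions and
  Skolem functions) and, for each tuple from `A`, the map sending `i` to a true member of the
  disjunction is almost constant (`hasLos`). Since `A` can be taken of cardinality `κ`, only `κ`
  maps `ι → ℕ` have to be almost constant, and the ultrafilter principle provides such a `D`
  (`infRelCompact_of_notArrowFamily`).

For `κ = λ`, the power `ω ^ λ` has a base of `λ` sets, so that final `λ`-compactness of it is
`[λ, λ]`-compactness, and relative compactness of the language is compactness.
-/

open Filter Set Topology

/-! ### Initial orders of regular cardinals -/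

/-- The order is a well-order of `ι` whose type is the initial ordinal of cardinality `#ι`. -/
theorem exists_linearOrder_card_Iic_lt {ι : Type u} (hι : ℵ₀ ≤ #ι) :
    ∃ _ : LinearOrder ι, ∀ i : ι, #(Iic i) < #ι := by
  obtain ⟨r, wo, hr⟩ := exists_ord_eq ι
  classical
  let _ : LinearOrder ι := linearOrderOfSTO r
  refine ⟨inferInstance, fun i => ?_⟩
  have h1 : #{j | r j i} < #ι := by
    have := card_typein_lt (r := r) i hr
    rwa [Ordinal.card_typein] at this
  have h2 : Iic i ⊆ insert i {j | r j i} := by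
    intro j hj
    exact hj
  refine (mk_le_mk_of_subset h2).trans_lt (mk_insert_le.trans_lt ?_)
  exact add_lt_of_lt hι h1 (one_lt_aleph0.trans_le hι)

theorem exists_forall_lt_of_card_lt {ι : Type u} [LinearOrder ι] (hreg : (#ι).IsRegular)
    (hIic : ∀ i : ι, #(Iic i) < #ι) {s : Set ι} (hs : #s < #ι) : ∃ i, ∀ j ∈ s, j < i := by
  have h : #(⋃ j ∈ s, Iic j) < #ι :=
    (card_biUnion_lt_iff_forall_of_isRegular hreg hs).2 fun j _ => hIic j
  obtain ⟨i, hi⟩ : ∃ i, i ∉ ⋃ j ∈ s, Iic j := by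
    by_contra! hcon
    rw [eq_univ_of_forall hcon, mk_univ] at h
    exact h.false
  refine ⟨i, fun j hj => ?_⟩
  simp only [mem_iUnion, mem_Iic, not_exists, not_le] at hi
  exact hi j hj

/-! ### Compactness and accumulation points -/

/-- For regular `λ`, `[λ, λ]`-compactness means that every sequence of length `λ` has a point all
of whose neighbourhoods contain `λ` terms of the sequence. -/
theorem isIntervalCompact_iff_forall_exists_mapClusterPt {ι X : Type u} [TopologicalSpace X]
    (hreg : (#ι).IsRegular) :
    IsIntervalCompact #ι #ι X ↔ ∀ g : ι → X, ∃ x, MapClusterPt x (cocardinal ι hreg) g := by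
  obtain ⟨_, hIic⟩ := exists_linearOrder_card_Iic_lt hreg.aleph0_le
  constructor
  · intro hX g
    by_contra! hg
    -- the largest open set missing the tail of the sequence that starts at `i`
    let V : ι → Set X := fun i => ⋃₀ {U | IsOpen U ∧ ∀ j, i ≤ j → g j ∉ U}
    have hVopen : ∀ U ∈ range V, IsOpen U := by
      rintro _ ⟨i, rfl⟩
      exact isOpen_sUnion fun U hU => hU.1
    have hVcov : ⋃₀ range V = Set.univ := by
      refine eq_univ_of_forall fun x => ?_
      have hx := hg x
      rw [mapClusterPt_iff_frequently] at hx
      push Not at hx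
      obtain ⟨s, hs, hsx⟩ := hx
      obtain ⟨U, hUs, hU, hxU⟩ := mem_nhds_iff.1 hs
      rw [eventually_cocardinal] at hsx
      obtain ⟨i, hi⟩ := exists_forall_lt_of_card_lt hreg hIic hsx
      refine ⟨V i, mem_range_self i, U, ⟨hU, fun j hij hj => ?_⟩, hxU⟩
      exact (hi j (not_not.2 (hUs hj))).not_ge hij
    obtain ⟨C', hC', hcov, hcard⟩ := hX (range V) hVopen hVcov mk_range_le
    choose idx hidx using fun U : C' => hC' U.2
    obtain ⟨i, hi⟩ := exists_forall_lt_of_card_lt hreg hIic (mk_range_le.trans_lt hcard)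
    obtain ⟨U, hU, hgU⟩ : g i ∈ ⋃₀ C' := hcov ▸ mem_univ _
    have hV : V (idx ⟨U, hU⟩) = U := hidx ⟨U, hU⟩
    rw [← hV] at hgU
    obtain ⟨W, hW, hgW⟩ := hgU
    exact hW.2 i (hi _ (mem_range_self _)).le hgW
  · intro hX C hC hcov hcard
    rcases C.eq_empty_or_nonempty with rfl | hne
    · exact ⟨∅, subset_rfl, hcov, by simpa using hreg.pos⟩
    have : Nonempty C := hne.to_subtype
    obtain ⟨U, hU⟩ : ∃ U : ι → C, Function.Surjective U := by
      obtain ⟨e⟩ := hcard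
      exact ⟨Function.invFun e, Function.invFun_surjective e.injective⟩
    by_contra! hcon
    -- the terms of the sequence with indices `≥ j` will lie outside `U j`
    have hstep : ∀ i, ∃ x, ∀ j ≤ i, x ∉ (U j : Set X) := by
      intro i
      by_contra! hi
      refine (hcon ((fun j => (U j : Set X)) '' Iic i) ?_ ?_).not_gt
        (mk_image_le.trans_lt (hIic i))
      · rintro _ ⟨j, -, rfl⟩
        exact (U j).2
      · refine eq_univ_of_forall fun x => ?_
        obtain ⟨j, hj, hx⟩ := hi x
        exact ⟨_, ⟨j, hj, rfl⟩, hx⟩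
    choose g hg using hstep
    obtain ⟨x, hx⟩ := hX g
    obtain ⟨W, hW, hxW⟩ : x ∈ ⋃₀ C := hcov ▸ mem_univ x
    obtain ⟨j, hj⟩ := hU ⟨W, hW⟩
    have hfr := (mapClusterPt_iff_frequently.1 hx) W ((hC W hW).mem_nhds hxW)
    rw [frequently_cocardinal] at hfr
    refine (hfr.trans (mk_le_mk_of_subset ?_)).not_gt (hIic j)
    intro i hi
    by_contra hij
    refine hg i j (not_le.1 hij).le ?_
    rw [hj]
    exact hi

/-! ### Uniform ultrafilters -/

theorem isUniformUltrafilter_iff_le_cocardinal {ι : Type u} (hreg : (#ι).IsRegular)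
    (D : Ultrafilter ι) : IsUniformUltrafilter D ↔ (D : Filter ι) ≤ cocardinal ι hreg := by
  constructor
  · intro hD s hs
    by_contra hsD
    exact (mem_cocardinal.1 hs).ne (hD _ (Ultrafilter.compl_mem_iff_notMem.2 hsD))
  · intro hD s hs
    refine (mk_set_le s).antisymm (le_of_not_gt fun hlt => ?_)
    exact Ultrafilter.compl_notMem_iff.2 hs (hD (compl_mem_cocardinal_of_card_lt hlt))

theorem not_isUniformUltrafilter_nat_iff (D : Ultrafilter ℕ) :
    ¬ IsUniformUltrafilter D ↔ ∃ n : ℕ, {n} ∈ D := by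
  constructor
  · intro h
    simp only [IsUniformUltrafilter, not_forall] at h
    obtain ⟨s, hs, hcard⟩ := h
    have hfin : s.Finite := by
      rw [← lt_aleph0_iff_set_finite]
      exact lt_of_le_of_ne ((mk_set_le s).trans_eq mk_nat) (mk_nat ▸ hcard)
    obtain ⟨n, -, rfl⟩ := Ultrafilter.eq_pure_of_finite_mem hfin hs
    exact ⟨n, by simp⟩
  · rintro ⟨n, hn⟩ h
    have := h _ hn
    rw [mk_singleton, mk_nat] at this
    exact one_lt_aleph0.ne this

/-- A uniform ultrafilter all of whose images under the `f γ` are non-uniform is the same as one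
along which the sequence `i ↦ (f γ i)_γ` converges in the product of copies of `ℕ`. -/
theorem notArrowFamily_nat_iff_forall_exists_mapClusterPt {ι : Type u} {K : Type v}
    (hreg : (#ι).IsRegular) :
    NotArrowFamily ι (fun _ : K => ℕ) ↔
      ∀ g : ι → K → ℕ, ∃ x, MapClusterPt x (cocardinal ι hreg) g := by
  have key : ∀ g : ι → K → ℕ, (∃ D : Ultrafilter ι, IsUniformUltrafilter D ∧
      ∀ γ : K, ¬ IsUniformUltrafilter (D.map fun i => g i γ)) ↔
      ∃ x, MapClusterPt x (cocardinal ι hreg) g := by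
    intro g
    simp only [mapClusterPt_iff_ultrafilter, isUniformUltrafilter_iff_le_cocardinal hreg,
      not_isUniformUltrafilter_nat_iff, tendsto_pi_nhds, nhds_discrete, tendsto_pure,
      Classical.skolem]
    constructor
    · rintro ⟨D, hD, x, hx⟩
      exact ⟨x, D, hD, hx⟩
    · rintro ⟨x, D, hD, hx⟩
      exact ⟨D, hD, x, hx⟩
  exact ⟨fun h g => (key g).1 (h fun γ i => g i γ), fun h f => (key fun i γ => f γ i).2 (h _)⟩

/-! ### Open covers of powers of `ℕ` -/

theorem mk_list_prod_nat_le {K : Type u} (hK : ℵ₀ ≤ #K) : #(List (K × ℕ)) ≤ #K := by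
  have : Infinite K := infinite_iff.2 hK
  rw [mk_list_eq_mk]
  simp [hK]

theorem exists_list_forall_eq_subset {K : Type u} {x : K → ℕ} {s : Set (K → ℕ)} (hs : s ∈ 𝓝 x) :
    ∃ l : List (K × ℕ), (∀ p ∈ l, x p.1 = p.2) ∧ {y : K → ℕ | ∀ p ∈ l, y p.1 = p.2} ⊆ s := by
  obtain ⟨U, hUs, hU, hxU⟩ := mem_nhds_iff.1 hs
  obtain ⟨I, u, hu, hsub⟩ := isOpen_pi_iff.1 hU x hxU
  refine ⟨I.toList.map fun a => (a, x a), ?_, fun y hy => hUs (hsub fun a ha => ?_)⟩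
  · intro p hp
    obtain ⟨a, -, rfl⟩ := List.mem_map.1 hp
    rfl
  · have : y a = x a := hy (a, x a) (List.mem_map.2 ⟨a, by simpa using ha, rfl⟩)
    rw [this]
    exact (hu a ha).2

/-- A power of `ℕ` with infinite index set `K` has a base of at most `#K` sets, so every open
cover of it has a subcover by at most `#K` sets. -/
theorem exists_subcover_card_le {K : Type u} (hK : ℵ₀ ≤ #K) (C : Set (Set (K → ℕ)))
    (hC : ∀ U ∈ C, IsOpen U) (hcov : ⋃₀ C = Set.univ) :
    ∃ C' ⊆ C, ⋃₀ C' = Set.univ ∧ #C' ≤ #K := by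
  let S : Set (List (K × ℕ)) := {l | ∃ U ∈ C, {y : K → ℕ | ∀ p ∈ l, y p.1 = p.2} ⊆ U}
  choose U hUC hBU using fun l : S => l.2
  refine ⟨range U, range_subset_iff.2 hUC, eq_univ_of_forall fun x => ?_,
    mk_range_le.trans ((mk_set_le S).trans (mk_list_prod_nat_le hK))⟩
  obtain ⟨W, hW, hxW⟩ : x ∈ ⋃₀ C := hcov ▸ mem_univ x
  obtain ⟨l, hxl, hl⟩ := exists_list_forall_eq_subset ((hC W hW).mem_nhds hxW)
  exact ⟨_, mem_range_self (⟨l, W, hW, hl⟩ : S), hBU _ hxl⟩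

theorem isFinallyCompact_omegaPower_iff {lam : Cardinal.{u}} (hlam : ℵ₀ ≤ lam) :
    IsFinallyCompact lam (OmegaPower lam) ↔ IsIntervalCompact lam lam (OmegaPower lam) := by
  refine ⟨fun h C hC hcov _ => h C hC hcov, fun h C hC hcov => ?_⟩
  obtain ⟨C₁, hC₁, hcov₁, hcard₁⟩ :=
    exists_subcover_card_le (K := lam.out) (by rwa [mk_out]) C hC hcov
  obtain ⟨C₂, hC₂, h₂⟩ := h C₁ (fun U hU => hC U (hC₁ hU)) hcov₁ (by rwa [mk_out] at hcard₁)
  exact ⟨C₂, hC₂.trans hC₁, h₂⟩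

/-! ### Accumulation points from compactness of the language -/

/-- The vocabulary whose only symbols are the elements of `P`, as relations without arguments. -/
def propLanguage (P : Type u) : FirstOrder.Language.{u, u} where
  Functions _ := PEmpty
  Relations n := match n with
    | 0 => P
    | _ + 1 => PEmpty

/-- The one-point structure given by a truth assignment. -/
@[reducible]
def propStructure {P : Type u} (v : P → Prop) : (propLanguage P).Structure PUnit.{u + 1} where
  funMap f := f.elim
  RelMap {n} R _ := match n, R with
    | 0, R => v R
    | _ + 1, R => PEmpty.elim R

/-- A propositional variable as a sentence. -/
def propAtom {P : Type u} (a : P) : InfSentence (propLanguage P) :=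
  .rel (l := 0) a Fin.elim0

/-- The formula `a₁ ∧ ⋯ ∧ aₙ → b`, written as the disjunction of the sequence
`¬ a₁, …, ¬ aₙ, b, b, …`. -/
def propImp {P : Type u} (l : List P) (b : P) : InfSentence (propLanguage P) :=
  .disj fun k => match l[k]? with
    | some a => .neg (propAtom a)
    | none => propAtom b

theorem realize_propAtom {P : Type u} (v : P → Prop) (a : P) :
    letI := propStructure v
    (propAtom a).Realize PUnit Fin.elim0 ↔ v a :=
  Iff.rfl

theorem realize_propImp {P M : Type u} [(propLanguage P).Structure M] (l : List P) (b : P) :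
    (propImp l b).Realize M Fin.elim0 ↔
      ((∀ a ∈ l, (propAtom a).Realize M Fin.elim0) → (propAtom b).Realize M Fin.elim0) := by
  change (∃ k : ℕ, InfFormula.Realize M _ _) ↔ _
  constructor
  · rintro ⟨k, hk⟩ h
    rcases hl : l[k]? with _ | a
    · simpa only [hl] using hk
    · simp only [hl] at hk
      exact (hk (h a (List.mem_of_getElem? hl))).elim
  · intro h
    by_cases hall : ∀ a ∈ l, (propAtom a).Realize M Fin.elim0
    · exact ⟨l.length, by simpa using h hall⟩
    · push Not at hall
      obtain ⟨a, ha, hna⟩ := hall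
      obtain ⟨k, hk⟩ := List.mem_iff_getElem?.1 ha
      exact ⟨k, by simpa only [hk, InfFormula.Realize] using hna⟩

/-- The sentences used describe a "point `i` of `ι` at infinity": the variable `(γ, n)` stands for
`g i γ = n` and the variable `b` for `i ≤ b`. A model in which no `b` is true yields an
accumulation point of `g`. -/
theorem exists_mapClusterPt_of_infRelCompact {ι K : Type u} (hreg : (#ι).IsRegular)
    (hιK : #ι ≤ #K) (h : InfRelCompact #K #ι #ι) (g : ι → K → ℕ) :
    ∃ x, MapClusterPt x (cocardinal ι hreg) g := by
  obtain ⟨_, hIic⟩ := exists_linearOrder_card_Iic_lt hreg.aleph0_le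
  have hK : ℵ₀ ≤ #K := hreg.aleph0_le.trans hιK
  let B : List (K × ℕ) → Set ι := fun l => {i | ∀ p ∈ l, g i p.1 = p.2}
  -- `γ` has a value; the indices satisfying a list of equations are bounded by `b`; `b < i`
  let defined : K → InfSentence (propLanguage (ι ⊕ K × ℕ)) :=
    fun γ => .disj fun n => propAtom (.inr (γ, n))
  let bounded : {p : List (K × ℕ) × ι // B p.1 ⊆ Iic p.2} →
      InfSentence (propLanguage (ι ⊕ K × ℕ)) :=
    fun p => propImp (p.1.1.map Sum.inr) (.inl p.1.2)
  let large : ι → InfSentence (propLanguage (ι ⊕ K × ℕ)) := fun b => .neg (propAtom (.inl b))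
  have hS : #(range defined ∪ range bounded : Set _) ≤ #K := by
    refine (mk_union_le _ _).trans (add_le_of_le hK mk_range_le (mk_range_le.trans ?_))
    refine (mk_subtype_le _).trans ?_
    rw [mk_prod, lift_id, lift_id]
    exact mul_le_of_le hK (mk_list_prod_nat_le hK) hιK
  have hrel : InfSatisfiableRel #ι (range defined ∪ range bounded) (range large) := by
    intro Γ' hΓ' hcard
    choose idx hidx using fun φ : Γ' => hΓ' φ.2
    obtain ⟨i, hi⟩ := exists_forall_lt_of_card_lt hreg hIic (mk_range_le.trans_lt hcard)
    -- the truth assignment given by the index `i`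
    let v : ι ⊕ K × ℕ → Prop := Sum.elim (fun b => i ≤ b) fun p => g i p.1 = p.2
    refine ⟨PUnit, inferInstance, propStructure v, ?_⟩
    rintro φ ((⟨γ, rfl⟩ | ⟨⟨⟨l, b⟩, hlb⟩, rfl⟩) | hφ)
    · exact ⟨g i γ, rfl⟩
    · let _ := propStructure v
      refine (realize_propImp _ _).2 fun hall => hlb fun p hp => ?_
      exact (realize_propAtom v (.inr p)).1 (hall _ (List.mem_map.2 ⟨p, hp, rfl⟩))
    · have := hidx ⟨φ, hφ⟩
      simp only at this
      rw [← this]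
      exact (hi _ (mem_range_self _)).not_ge
  obtain ⟨M, -, str, hM⟩ := h _ _ (range large) hS mk_range_le hrel
  have hdef : ∀ γ, ∃ n, (propAtom (.inr (γ, n)) :
      InfSentence (propLanguage (ι ⊕ K × ℕ))).Realize M Fin.elim0 :=
    fun γ => hM (defined γ) (.inl (.inl (mem_range_self γ)))
  choose x hx using hdef
  refine ⟨x, mapClusterPt_iff_frequently.2 fun s hs => ?_⟩
  rw [frequently_cocardinal]
  by_contra! hlt
  obtain ⟨l, hxl, hls⟩ := exists_list_forall_eq_subset hs
  obtain ⟨b, hb⟩ := exists_forall_lt_of_card_lt hreg hIic hlt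
  have hBl : B l ⊆ Iic b := fun i hi => (hb i (hls hi)).le
  refine hM (large b) (.inr (mem_range_self b)) ?_
  refine (realize_propImp _ _).1
    (hM (bounded ⟨(l, b), hBl⟩) (.inl (.inr (mem_range_self _)))) ?_
  intro a ha
  obtain ⟨p, hp, rfl⟩ := List.mem_map.1 ha
  have := hx p.1
  rwa [hxl p hp] at this

/-! ### Partial ultraproducts -/

section PartialUltraproduct

open FirstOrder.Language

variable {ι : Type u} {L : FirstOrder.Language.{u, u}} {M : ι → Type u}

/-- The elements of the ultraproduct of the `M i` that are represented by a member of `A`. -/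
def PartialUltraproduct (D : Ultrafilter ι) (A : Set (∀ i, M i)) : Type u :=
  {x : (D : Filter ι).Product M // ∃ a ∈ A, (a : (D : Filter ι).Product M) = x}

namespace PartialUltraproduct

variable {D : Ultrafilter ι} {A : Set (∀ i, M i)}

/-- The class of a member of `A`. -/
def mk (D : Ultrafilter ι) (a : A) : PartialUltraproduct D A :=
  ⟨(a : ∀ i, M i), a, a.2, rfl⟩

theorem mk_surjective : Function.Surjective (mk D : A → PartialUltraproduct D A) := by
  rintro ⟨_, a, ha, rfl⟩
  exact ⟨⟨a, ha⟩, rfl⟩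

theorem mk_eq_mk {a b : A} : mk D a = mk D b ↔ ∀ᶠ i in D, a.1 i = b.1 i :=
  Subtype.ext_iff.trans Quotient.eq''

instance [Nonempty A] : Nonempty (PartialUltraproduct D A) :=
  .map (mk D) inferInstance

variable [∀ i, L.Structure (M i)]

open Classical in
/-- Relations are those of the ultraproduct. So are functions where their value is represented in
`A`; their other values are arbitrary. -/
noncomputable instance [Nonempty A] : L.Structure (PartialUltraproduct D A) where
  funMap f x :=
    if h : ∃ a ∈ A, (a : (D : Filter ι).Product M) =
        Structure.funMap f fun j => (x j).1 then ⟨_, h⟩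
    else Classical.arbitrary _
  RelMap R x := Structure.RelMap R fun j => (x j).1

theorem funMap_mk [Nonempty A] {n : ℕ} (f : L.Functions n) (a : Fin n → A)
    (ha : (fun i => Structure.funMap f fun j => (a j).1 i) ∈ A) :
    Structure.funMap f (fun j => mk D (a j)) = mk D ⟨_, ha⟩ := by
  have h := Ultraproduct.funMap_cast (u := D) f fun j => (a j).1
  refine (dif_pos ⟨_, ha, h.symm⟩).trans (Subtype.ext h)

theorem relMap_mk [Nonempty A] {n : ℕ} (R : L.Relations n) (a : Fin n → A) :
    Structure.RelMap R (fun j => mk D (a j)) ↔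
      ∀ᶠ i in D, Structure.RelMap R fun j => (a j).1 i :=
  relMap_quotient_mk' (s := (D : Filter ι).productSetoid M)
    (ps := Ultraproduct.setoidPrestructure M D) R fun j => (a j).1

end PartialUltraproduct

/-- Closedness of a set under a family of finitary operations. -/
def ClosedUnder {X : Type u} (O : Set (Σ n : ℕ, (Fin n → X) → X)) (A : Set X) : Prop :=
  ∀ o ∈ O, ∀ a : Fin o.1 → A, o.2 (fun j => (a j).1) ∈ A

theorem ClosedUnder.mono {X : Type u} {O O' : Set (Σ n : ℕ, (Fin n → X) → X)} {A : Set X}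
    (h : ClosedUnder O' A) (hO : O ⊆ O') : ClosedUnder O A :=
  fun o ho => h o (hO ho)

theorem exists_closedUnder_card_le {X : Type u} [Nonempty X] {κ : Cardinal.{u}} (hκ : ℵ₀ ≤ κ)
    (O : Set (Σ n : ℕ, (Fin n → X) → X)) (hO : #O ≤ κ) :
    ∃ A : Set X, A.Nonempty ∧ ClosedUnder O A ∧ #A ≤ κ := by
  -- a language with a function symbol for each operation: the set sought is a substructure
  let L' : FirstOrder.Language.{u, u} :=
    ⟨fun n => {f : (Fin n → X) → X // ⟨n, f⟩ ∈ O}, fun _ => PEmpty⟩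
  let _ : L'.Structure X := ⟨fun f => f.1, fun R => R.elim⟩
  obtain ⟨x⟩ := ‹Nonempty X›
  refine ⟨Substructure.closure L' {x}, ⟨x, Substructure.subset_closure rfl⟩, ?_, ?_⟩
  · rintro ⟨n, f⟩ hf a
    exact (Substructure.closure L' {x}).fun_mem (⟨f, hf⟩ : L'.Functions n) _ fun j => (a j).2
  · have h := Substructure.lift_card_closure_le (L := L') (s := {x})
    rw [Cardinal.lift_id, Cardinal.lift_id, Cardinal.lift_id] at h
    refine h.trans (max_le hκ (add_le_of_le hκ ?_ ?_))
    · rw [mk_singleton]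
      exact one_le_aleph0.trans hκ
    · refine le_trans (mk_le_of_injective
        (f := fun p : Σ n, L'.Functions n => (⟨⟨p.1, p.2.1⟩, p.2.2⟩ : O)) ?_) hO
      rintro ⟨n, f, hf⟩ ⟨m, g, hg⟩ h
      simp only [Subtype.mk.injEq, Sigma.mk.injEq] at h
      obtain ⟨rfl, h⟩ := h
      obtain rfl := eq_of_heq h
      rfl

/-- The maps in `G` take almost constant values on tuples from `A`. -/
def AlmostConst {X : Type u} (G : Set (Σ n : ℕ, (Fin n → X) → ι → ℕ)) (D : Ultrafilter ι)
    (A : Set X) : Prop :=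
  ∀ o ∈ G, ∀ a : Fin o.1 → A, ∃ k, ∀ᶠ i in D, o.2 (fun j => (a j).1) i = k

theorem AlmostConst.mono {X : Type u} {G G' : Set (Σ n : ℕ, (Fin n → X) → ι → ℕ)}
    {D : Ultrafilter ι} {A : Set X} (h : AlmostConst G' D A) (hG : G ⊆ G') : AlmostConst G D A :=
  fun o ho => h o (hG ho)

variable [∀ i, L.Structure (M i)]

open PartialUltraproduct

/-- A term has the pointwise value in partial ultraproducts with enough elements. -/
theorem exists_countable_realize_term {n : ℕ} (t : L.Term (Fin n)) :
    ∃ O : Set (Σ n : ℕ, (Fin n → ∀ i, M i) → ∀ i, M i), O.Countable ∧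
      ∀ (D : Ultrafilter ι) (A : Set (∀ i, M i)) [Nonempty A], ClosedUnder O A →
        ∀ a : Fin n → A, ∃ h : (fun i => t.realize fun j => (a j).1 i) ∈ A,
          t.realize (fun j => mk D (a j)) = mk D ⟨_, h⟩ := by
  induction t with
  | var j => exact ⟨∅, countable_empty, fun D A _ _ a => ⟨(a j).2, rfl⟩⟩
  | @func l f ts ih =>
    choose O hO h using ih
    refine ⟨insert ⟨l, fun b i => Structure.funMap f fun j => b j i⟩ (⋃ j, O j),
      (countable_iUnion hO).insert _, fun D A _ hA a => ?_⟩
    have hts := fun j => h j D A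
      (hA.mono ((subset_iUnion O j).trans (subset_insert _ _))) a
    choose hmem heq using hts
    have hcl := hA _ (mem_insert _ _) fun j => ⟨_, hmem j⟩
    refine ⟨hcl, ?_⟩
    simp only [Term.realize, heq]
    exact funMap_mk f (fun j => ⟨_, hmem j⟩) hcl

variable (M) in
/-- Łoś's theorem holds for `φ` in every partial ultraproduct whose set of representatives is
closed under certain countably many operations, and whose ultrafilter makes certain countably many
maps to `ℕ` almost constant. -/
def HasLos {n : ℕ} (φ : InfFormula L n) : Prop :=
  ∃ (O : Set (Σ n : ℕ, (Fin n → ∀ i, M i) → ∀ i, M i))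
    (G : Set (Σ n : ℕ, (Fin n → ∀ i, M i) → ι → ℕ)), O.Countable ∧ G.Countable ∧
      ∀ (D : Ultrafilter ι) (A : Set (∀ i, M i)) [Nonempty A], ClosedUnder O A →
        AlmostConst G D A → ∀ a : Fin n → A,
          (φ.Realize (PartialUltraproduct D A) (fun j => mk D (a j)) ↔
            ∀ᶠ i in D, φ.Realize (M i) fun j => (a j).1 i)

/-- Conjunctions and universal quantifiers are reduced by this to the other connectives. -/
theorem HasLos.congr {n : ℕ} {φ ψ : InfFormula L n} (hφ : HasLos M φ)
    (h : ∀ (N : Type u) [L.Structure N] (x : Fin n → N), φ.Realize N x ↔ ψ.Realize N x) :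
    HasLos M ψ := by
  obtain ⟨O, G, hO, hG, hlos⟩ := hφ
  exact ⟨O, G, hO, hG, fun D A _ hA hD a => by simpa only [h] using hlos D A hA hD a⟩

theorem hasLos_falsum {n : ℕ} : HasLos M (.falsum : InfFormula L n) :=
  ⟨∅, ∅, countable_empty, countable_empty, fun D A _ _ _ a => by
    simp only [InfFormula.Realize, eventually_const]⟩

theorem hasLos_equal {n : ℕ} (t s : L.Term (Fin n)) : HasLos M (.equal t s) := by
  obtain ⟨O₁, hO₁, h₁⟩ := exists_countable_realize_term (M := M) t
  obtain ⟨O₂, hO₂, h₂⟩ := exists_countable_realize_term (M := M) s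
  refine ⟨O₁ ∪ O₂, ∅, hO₁.union hO₂, countable_empty, fun D A _ hA _ a => ?_⟩
  obtain ⟨_, ht⟩ := h₁ D A (hA.mono subset_union_left) a
  obtain ⟨_, hs⟩ := h₂ D A (hA.mono subset_union_right) a
  simp only [InfFormula.Realize, ht, hs, mk_eq_mk]

theorem hasLos_rel {n l : ℕ} (R : L.Relations l) (ts : Fin l → L.Term (Fin n)) :
    HasLos M (.rel R ts) := by
  choose O hO h using fun j => exists_countable_realize_term (M := M) (ts j)
  refine ⟨⋃ j, O j, ∅, countable_iUnion hO, countable_empty, fun D A _ hA _ a => ?_⟩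
  choose hmem heq using fun j => h j D A (hA.mono (subset_iUnion O j)) a
  simp only [InfFormula.Realize, heq]
  exact relMap_mk R fun j => ⟨_, hmem j⟩

theorem HasLos.neg {n : ℕ} {φ : InfFormula L n} (hφ : HasLos M φ) : HasLos M (.neg φ) := by
  obtain ⟨O, G, hO, hG, hlos⟩ := hφ
  refine ⟨O, G, hO, hG, fun D A _ hA hD a => ?_⟩
  simp only [InfFormula.Realize, hlos D A hA hD a, Ultrafilter.eventually_not]

/-- The index of a true member of the disjunction has to be almost constant. -/
theorem HasLos.disj {n : ℕ} {φ : ℕ → InfFormula L n} (hφ : ∀ k, HasLos M (φ k)) :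
    HasLos M (.disj φ) := by
  classical
  choose O G hO hG hlos using hφ
  let g : (Fin n → ∀ i, M i) → ι → ℕ := fun a i =>
    if h : ∃ k, (φ k).Realize (M i) fun j => a j i then h.choose else 0
  refine ⟨⋃ k, O k, insert ⟨n, g⟩ (⋃ k, G k), countable_iUnion hO,
    (countable_iUnion hG).insert _, fun D A _ hA hD a => ?_⟩
  have hk := fun k => hlos k D A (hA.mono (subset_iUnion O k))
    (hD.mono ((subset_iUnion G k).trans (subset_insert _ _))) a
  simp only [InfFormula.Realize, hk]
  refine ⟨fun ⟨k, h⟩ => h.mono fun i hi => ⟨k, hi⟩, fun h => ?_⟩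
  obtain ⟨k, hgk⟩ := hD _ (mem_insert _ _) a
  refine ⟨k, ?_⟩
  filter_upwards [h, hgk] with i hi hik
  rw [← hik]
  simp only [g, dif_pos hi]
  exact hi.choose_spec

/-- The set of representatives has to be closed under a Skolem function. -/
theorem HasLos.ex [∀ i, Nonempty (M i)] {n : ℕ} {φ : InfFormula L (n + 1)} (hφ : HasLos M φ) :
    HasLos M (.ex φ) := by
  classical
  obtain ⟨O, G, hO, hG, hlos⟩ := hφ
  let sk : (Fin n → ∀ i, M i) → ∀ i, M i := fun a i =>
    if h : ∃ y, φ.Realize (M i) (Fin.snoc (α := fun _ => M i) (fun j => a j i) y) then h.choose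
    else Classical.arbitrary _
  refine ⟨insert ⟨n, sk⟩ O, G, hO.insert _, hG, fun D A _ hA hD a => ?_⟩
  have key : ∀ c : A, φ.Realize (PartialUltraproduct D A)
      (Fin.snoc (α := fun _ => PartialUltraproduct D A) (fun j => mk D (a j)) (mk D c)) ↔
      ∀ᶠ i in D, φ.Realize (M i) (Fin.snoc (α := fun _ => M i) (fun j => (a j).1 i) (c.1 i)) := by
    intro c
    have h := hlos D A (hA.mono (subset_insert _ _)) hD (Fin.snoc (α := fun _ => A) a c)
    have h₁ := Fin.comp_snoc (mk D) a c
    have h₂ := fun i => Fin.comp_snoc (fun b : A => b.1 i) a c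
    simp only [Function.comp_def] at h₁ h₂
    simpa only [h₁, h₂] using h
  simp only [InfFormula.Realize]
  rw [mk_surjective.exists]
  simp only [key]
  refine ⟨fun ⟨c, h⟩ => h.mono fun i hi => ⟨_, hi⟩, fun h => ?_⟩
  refine ⟨⟨_, hA _ (mem_insert _ _) a⟩, h.mono fun i hi => ?_⟩
  simp only [sk, dif_pos hi]
  exact hi.choose_spec

theorem hasLos [∀ i, Nonempty (M i)] {n : ℕ} (φ : InfFormula L n) : HasLos M φ := by
  induction φ with
  | falsum => exact hasLos_falsum
  | equal t s => exact hasLos_equal t s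
  | rel R ts => exact hasLos_rel R ts
  | neg φ ih => exact ih.neg
  | conj φ ih =>
    exact (HasLos.disj fun k => (ih k).neg).neg.congr fun N _ x => by
      simp only [InfFormula.Realize, not_exists, not_not]
  | disj φ ih => exact .disj ih
  | all φ ih =>
    exact ih.neg.ex.neg.congr fun N _ x => by
      simp only [InfFormula.Realize, not_exists, not_not]
  | ex φ ih => exact ih.ex

end PartialUltraproduct

/-! ### Compactness of the language -/

/-- The model is a partial ultraproduct. It has few enough representatives that the ultrafilter
principle makes all the maps required for Łoś's theorem almost constant. -/
theorem infSatisfiable_of_notArrowFamily {ι K : Type u} (hreg : (#ι).IsRegular) (hK : ℵ₀ ≤ #K)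
    (h : NotArrowFamily ι fun _ : K => ℕ) {L : FirstOrder.Language.{u, u}} (M : ι → Type u)
    [∀ i, L.Structure (M i)] [∀ i, Nonempty (M i)] (T : Set (InfSentence L)) (hT : #T ≤ #K)
    (hM : ∀ φ ∈ T, ∀ᶠ i in cocardinal ι hreg, φ.Realize (M i) Fin.elim0) : InfSatisfiable T := by
  choose O G hO hG hlos using fun φ : T => hasLos (M := M) φ.1
  have hcount : ∀ {Y : Type u} (S : T → Set Y), (∀ φ, (S φ).Countable) → #(⋃ φ, S φ) ≤ #K := by
    intro Y S hS
    refine (mk_iUnion_le S).trans (mul_le_of_le hK hT (ciSup_le' fun φ => ?_))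
    exact (le_aleph0_iff_set_countable.2 (hS φ)).trans hK
  obtain ⟨A, hne, hA, hcard⟩ := exists_closedUnder_card_le hK _ (hcount O hO)
  have : Nonempty A := hne.to_subtype
  -- the maps that have to be almost constant, with their arguments
  let I : Type u := Σ o : ↥(⋃ φ, G φ), Fin o.1.1 → A
  have hI : #I ≤ #K := by
    rw [mk_sigma]
    refine (sum_le_mk_mul_iSup _).trans (mul_le_of_le hK (hcount G hG) (ciSup_le' fun o => ?_))
    simpa using (power_le_power_right hcard).trans (power_nat_le hK)
  obtain ⟨e⟩ := hI
  obtain ⟨D, hD, hconst⟩ := h (Function.extend e (fun p : I => p.1.1.2 fun j => (p.2 j).1) 0)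
  simp only [not_isUniformUltrafilter_nat_iff] at hconst
  have hGD : AlmostConst (⋃ φ, G φ) D A := by
    intro o ho a
    obtain ⟨k, hk⟩ := hconst (e ⟨⟨o, ho⟩, a⟩)
    rw [e.injective.extend_apply] at hk
    exact ⟨k, hk⟩
  refine ⟨PartialUltraproduct D A, inferInstance, inferInstance, fun φ hφ => ?_⟩
  have hφ' := hlos ⟨φ, hφ⟩ D A (hA.mono (subset_iUnion O _)) (hGD.mono (subset_iUnion G _))
    Fin.elim0
  rw [Subsingleton.elim (fun j => PartialUltraproduct.mk D (Fin.elim0 j)) Fin.elim0] at hφ'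
  have hev : ∀ᶠ i in D, φ.Realize (M i) Fin.elim0 :=
    (isUniformUltrafilter_iff_le_cocardinal hreg D).1 hD (hM φ hφ)
  refine hφ'.2 (hev.mono fun i hi => ?_)
  rwa [Subsingleton.elim (fun j : Fin 0 => (Fin.elim0 j : A).1 i) Fin.elim0]

theorem infRelCompact_of_notArrowFamily {ι K : Type u} (hreg : (#ι).IsRegular) (hιK : #ι ≤ #K)
    (h : NotArrowFamily ι fun _ : K => ℕ) : InfRelCompact #K #ι #ι := by
  intro L S Γ hS hΓ hrel
  have hK : ℵ₀ ≤ #K := hreg.aleph0_le.trans hιK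
  rcases Γ.eq_empty_or_nonempty with rfl | hne
  · exact hrel ∅ subset_rfl (by simpa using hreg.pos)
  have : Nonempty Γ := hne.to_subtype
  obtain ⟨_, hIic⟩ := exists_linearOrder_card_Iic_lt hreg.aleph0_le
  obtain ⟨e, he⟩ : ∃ e : ι → Γ, Function.Surjective e := by
    obtain ⟨f⟩ := hΓ
    exact ⟨Function.invFun f, Function.invFun_surjective f.injective⟩
  -- `M i` is a model of `S` and of the members of `Γ` with numbers up to `i`
  choose M hMne hMstr hM using fun i => hrel ((fun j => (e j).1) '' Iic i)
    (image_subset_iff.2 fun j _ => (e j).2) (mk_image_le.trans_lt (hIic i))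
  refine infSatisfiable_of_notArrowFamily hreg hK h M (S ∪ Γ)
    ((mk_union_le S Γ).trans (add_le_of_le hK hS (hΓ.trans hιK))) ?_
  rintro φ (hφ | hφ)
  · exact .of_forall fun i => hM i φ (.inl hφ)
  · obtain ⟨j, hj⟩ := he ⟨φ, hφ⟩
    refine mem_of_superset (compl_mem_cocardinal_of_card_lt (hIic j)) fun i hi => ?_
    exact hM i φ (.inr ⟨j, (not_le.1 hi).le, congrArg Subtype.val hj⟩)

theorem infCompact_iff_infRelCompact {lam : Cardinal.{u}} (hlam : ℵ₀ ≤ lam) :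
    InfCompact lam lam ↔ InfRelCompact lam lam lam := by
  constructor
  · intro h L S Γ hS hΓ hrel
    refine h L (S ∪ Γ) ((mk_union_le S Γ).trans (add_le_of_le hlam hS hΓ)) fun T hT hcard => ?_
    obtain ⟨M, hne, str, hM⟩ := hrel (T ∩ Γ) inter_subset_right
      ((mk_le_mk_of_subset inter_subset_left).trans_lt hcard)
    refine ⟨M, hne, str, fun φ hφ => hM φ ?_⟩
    exact (hT hφ).imp id fun h' => ⟨hφ, h'⟩
  · intro h L Γ hΓ hsat
    have := h L ∅ Γ (by simp) hΓ fun Γ' hΓ' hcard => by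
      simpa using hsat Γ' hΓ' hcard
    simpa using this

theorem mainTheorem1 (lam : Cardinal.{u}) (hlam : lam.IsRegular) :
    (∀ kappa : Cardinal.{u}, lam ≤ kappa →
      List.TFAE
        [IsIntervalCompact lam lam (OmegaPower kappa),
         InfRelCompact kappa lam lam,
         NotArrowOmega lam kappa]) ∧
    (IsFinallyCompact lam (OmegaPower lam) ↔ InfCompact lam lam) := by
  have hreg : (#lam.out).IsRegular := by rwa [mk_out]
  have htfae : ∀ kappa : Cardinal.{u}, lam ≤ kappa →
      List.TFAE
        [IsIntervalCompact lam lam (OmegaPower kappa),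
         InfRelCompact kappa lam lam,
         NotArrowOmega lam kappa] := by
    intro kappa hle
    have hcard : #lam.out ≤ #kappa.out := by rwa [mk_out, mk_out]
    have harrow : NotArrowOmega lam kappa ↔ _ :=
      notArrowFamily_nat_iff_forall_exists_mapClusterPt hreg
    have hspace := isIntervalCompact_iff_forall_exists_mapClusterPt (X := OmegaPower kappa) hreg
    have hcompact : IsIntervalCompact lam lam (OmegaPower kappa) ↔
        IsIntervalCompact #lam.out #lam.out (OmegaPower kappa) := by rw [mk_out]
    have hrel : InfRelCompact kappa lam lam ↔
        InfRelCompact #kappa.out #lam.out #lam.out := by rw [mk_out, mk_out]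
    tfae_have 1 ↔ 3 := hcompact.trans (hspace.trans harrow.symm)
    tfae_have 3 → 2 := fun h =>
      hrel.2 (infRelCompact_of_notArrowFamily hreg hcard h)
    tfae_have 2 → 3 := fun h =>
      harrow.2 (exists_mapClusterPt_of_infRelCompact hreg hcard (hrel.1 h))
    tfae_finish
  refine ⟨htfae, ?_⟩
  rw [isFinallyCompact_omegaPower_iff hlam.aleph0_le, infCompact_iff_infRelCompact hlam.aleph0_le]
  exact (htfae lam le_rfl).out 0 1
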